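/- Let $K$ be a field of characteristic $0$ and let $\alpha,\beta\in K$. Let $A=A(\alpha,\beta,0)$ be the down-up algebra, that is, the quotient of the free associative algebra $K\langle d,u\rangle$ by the two-sided ideal generated by $$d^2u-\alpha\,dud-\beta\,ud^2,\qquad du^2-\alpha\,udu-\beta\,u^2d .$$ Assume that $A$ is graded generic: $(\alpha,\beta)\neq(0,0)$, and the two roots $r_1,r_2$ (in an algebraic closure of $K$, with multiplicity) of $t^2-\alpha t-\beta$ satisfy $r_1^i r_2^j\neq 1$ for all integers $i,j\ge 0$ with $(i,j)\neq(0,0)$. Let $HH^1(A)=\operatorname{Der}_K(A)/\operatorname{InnDer}(A)$ be the first Hochschild cohomology space of $A$, i.e. the degree-one cohomology of the Hochschild cochain complex $A\to\operatorname{Hom}_K(A,A)\to\operatorname{Hom}_K(A\otimes A,A)\to\cdots$. Let $V=Kd\oplus Ku$ with dual basis $D,U$ of $V^*$, and for $a,b\in A$ write $D|a+U|b$ for the corresponding element of $V^*\otimes A$. Consider the sequence $$A\xrightarrow{\,d_0^*\,}V^*\otimes A\xrightarrow{\,d_1^*\,}A\oplus A$$ with $d_0^*(a)=D|(da-ad)+U|(ua-au)$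 and $d_1^*(D|a'+U|a)=(\Delta_1,\Delta_2)$, where $$\Delta_1=d^2a+a'du+da'u-\alpha(dad+a'ud+dua')-\beta(ad^2+ua'd+uda'),$$ $$\Delta_2=dau+dua+a'u^2-\alpha(adu+uda+ua'u)-\beta(aud+uad+u^2a').$$ Then: 1. restriction to the generators, $\delta\mapsto D|\delta(d)+U|\delta(u)$, induces an isomorphism $HH^1(A)\cong\operatorname{Ker}d_1^*/\operatorname{Im}d_0^*$; 2. $\dim_K HH^1(A)=2$; 3. there are derivations of $A$ which restrict to $D|d$ and to $U|u$, i.e. $\delta_d$ with $\delta_d(d)=d$, $\delta_d(u)=0$, and $\delta_u$ with $\delta_u(d)=0$, $\delta_u(u)=u$, and their classes span $HH^1(A)$. -/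

import Mathlib

set_option maxSynthPendingDepth 3

/-! ### Hochschild cohomology in degree one -/

section Hochschild

variable (K : Type*) (A : Type*) [CommRing K] [Ring A] [Algebra K A]

/-- The Hochschild differential `C⁰(A, A) = A → C¹(A, A) = Hom_K(A, A)`,
sending `a` to the inner derivation `b ↦ b * a - a * b`. -/
def hochschildD0 : A →ₗ[K] (A →ₗ[K] A) :=
  (LinearMap.mul K A).flip - LinearMap.mul K A

/-- The Hochschild differential `C¹(A, A) → C²(A, A)`, where `C²(A, A)` is the space of
`K`-bilinear maps `A × A → A`:
`f ↦ ((a, b) ↦ a * f b - f (a * b) + f a * b)`. -/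
def hochschildD1 : (A →ₗ[K] A) →ₗ[K] (A →ₗ[K] A →ₗ[K] A) where
  toFun f := (LinearMap.mul K A).compl₂ f - (LinearMap.mul K A).compr₂ f
    + (LinearMap.mul K A).comp f
  map_add' f g := by
    ext a b
    simp [mul_add]
    abel
  map_smul' c f := by
    ext a b
    simp [smul_sub, smul_add]

theorem hochschildD0_apply (a b : A) : hochschildD0 K A a b = b * a - a * b := rfl

theorem hochschildD1_apply (f : A →ₗ[K] A) (a b : A) :
    hochschildD1 K A f a b = a * f b - f (a * b) + f a * b := rfl

/-- Hochschild `1`-cocycles, i.e. `K`-linear derivations `A → A`. -/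
abbrev HochschildZ1 : Submodule K (A →ₗ[K] A) := LinearMap.ker (hochschildD1 K A)

/-- Hochschild `1`-coboundaries, i.e. inner derivations. -/
abbrev HochschildB1 : Submodule K (A →ₗ[K] A) := LinearMap.range (hochschildD0 K A)

theorem hochschildB1_le_hochschildZ1 : HochschildB1 K A ≤ HochschildZ1 K A := by
  rintro _ ⟨a, rfl⟩
  rw [LinearMap.mem_ker]
  ext b c
  simp only [hochschildD1_apply, hochschildD0_apply, LinearMap.zero_apply]
  noncomm_ring

/-- The first Hochschild cohomology space `HH¹(A) = HH¹(A, A)`. -/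
abbrev HochschildHH1 : Type _ :=
  HochschildZ1 K A ⧸ (HochschildB1 K A).submoduleOf (HochschildZ1 K A)

theorem hochschildZ1_leibniz {f : A →ₗ[K] A} (hf : f ∈ HochschildZ1 K A) (a b : A) :
    f (a * b) = a * f b + f a * b := by
  have h := hochschildD1_apply K A f a b
  rw [LinearMap.mem_ker.mp hf] at h
  simp only [LinearMap.zero_apply] at h
  have h2 : a * f b + f a * b - f (a * b) = 0 := by rw [h]; abel
  exact (sub_eq_zero.mp h2).symm

end Hochschild

/-! ### Down-up algebras -/

namespace DownUp

/-- The two generators `d` and `u`; also the basis of the space `V`. -/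
inductive Gen
  | d
  | u
  deriving DecidableEq

variable {K : Type*} [Field K]

/-- The defining relations of the down-up algebra:
`d²u = α dud + β ud² + γ d` and `du² = α udu + β u²d + γ u`. -/
inductive Rel (α β γ : K) : FreeAlgebra K Gen → FreeAlgebra K Gen → Prop
  | ddu : Rel α β γ
      (FreeAlgebra.ι K Gen.d * FreeAlgebra.ι K Gen.d * FreeAlgebra.ι K Gen.u)
      (α • (FreeAlgebra.ι K Gen.d * FreeAlgebra.ι K Gen.u * FreeAlgebra.ι K Gen.d)
        + β • (FreeAlgebra.ι K Gen.u * FreeAlgebra.ι K Gen.d * FreeAlgebra.ι K Gen.d)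
        + γ • FreeAlgebra.ι K Gen.d)
  | duu : Rel α β γ
      (FreeAlgebra.ι K Gen.d * FreeAlgebra.ι K Gen.u * FreeAlgebra.ι K Gen.u)
      (α • (FreeAlgebra.ι K Gen.u * FreeAlgebra.ι K Gen.d * FreeAlgebra.ι K Gen.u)
        + β • (FreeAlgebra.ι K Gen.u * FreeAlgebra.ι K Gen.u * FreeAlgebra.ι K Gen.d)
        + γ • FreeAlgebra.ι K Gen.u)

/-- The down-up algebra `A(α, β, γ)`: the quotient of the free associative algebra on `d, u`
by the two-sided ideal generated by the relations. -/
abbrev Alg (α β γ : K) : Type _ := RingQuot (Rel α β γ)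

/-- The image in `A(α, β, γ)` of a generator. -/
def gen (α β γ : K) (g : Gen) : Alg α β γ :=
  RingQuot.mkAlgHom K (Rel α β γ) (FreeAlgebra.ι K g)

theorem gen_ddu (α β γ : K) :
    gen α β γ Gen.d * gen α β γ Gen.d * gen α β γ Gen.u
      = α • (gen α β γ Gen.d * gen α β γ Gen.u * gen α β γ Gen.d)
        + β • (gen α β γ Gen.u * gen α β γ Gen.d * gen α β γ Gen.d)
        + γ • gen α β γ Gen.d := by
  simpa [gen] using RingQuot.mkAlgHom_rel K (Rel.ddu (α := α) (β := β) (γ := γ))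

theorem gen_duu (α β γ : K) :
    gen α β γ Gen.d * gen α β γ Gen.u * gen α β γ Gen.u
      = α • (gen α β γ Gen.u * gen α β γ Gen.d * gen α β γ Gen.u)
        + β • (gen α β γ Gen.u * gen α β γ Gen.u * gen α β γ Gen.d)
        + γ • gen α β γ Gen.u := by
  simpa [gen] using RingQuot.mkAlgHom_rel K (Rel.duu (α := α) (β := β) (γ := γ))

/-- The family of graded generic down-up algebras `A(α, β, 0)`: `(α, β) ≠ (0, 0)` and the
roots `r₁, r₂` (in an algebraic closure, with multiplicity) of `t² - α t - β` satisfy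
`r₁ ^ i * r₂ ^ j ≠ 1` for all `(i, j) ≠ (0, 0)`. -/
def IsGradedGeneric (α β : K) : Prop :=
  (α, β) ≠ (0, 0) ∧
    ∀ r₁ r₂ : AlgebraicClosure K,
      (Polynomial.X ^ 2 - Polynomial.C (algebraMap K (AlgebraicClosure K) α) * Polynomial.X
          - Polynomial.C (algebraMap K (AlgebraicClosure K) β)
        = (Polynomial.X - Polynomial.C r₁) * (Polynomial.X - Polynomial.C r₂)) →
      ∀ i j : ℕ, (i, j) ≠ (0, 0) → r₁ ^ i * r₂ ^ j ≠ 1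

/-! ### The complex obtained from the short bimodule resolution

`V* ⊗ A` is written as `Gen → A`, the element `D|a + U|b` being the function `d ↦ a`, `u ↦ b`;
`R* ⊗ A` is written as `A × A`, the element `D²U|a + DU²|b` being the pair `(a, b)`. -/

/-- The differential `d₀* : A → V* ⊗ A`, `a ↦ U|(ua - au) + D|(da - ad)`. -/
def koszulD0 (α β γ : K) : Alg α β γ →ₗ[K] (Gen → Alg α β γ) where
  toFun a := fun g => gen α β γ g * a - a * gen α β γ g
  map_add' a b := by
    funext g
    simp only [Pi.add_apply]
    noncomm_ring
  map_smul' c a := by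
    funext g
    simp [smul_sub]

/-- The differential `d₁* : V* ⊗ A → R* ⊗ A`, `x ↦ D²U|Δ₁(x) + DU²|Δ₂(x)`. -/
def koszulD1 (α β γ : K) : (Gen → Alg α β γ) →ₗ[K] Alg α β γ × Alg α β γ where
  toFun x :=
    let d := gen α β γ Gen.d
    let u := gen α β γ Gen.u
    let a := x Gen.u
    let a' := x Gen.d
    (d * d * a + a' * d * u + d * a' * u
        - α • (d * a * d + a' * u * d + d * u * a')
        - β • (a * d * d + u * a' * d + u * d * a')
        - γ • a',
      d * a * u + d * u * a + a' * u * u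
        - α • (a * d * u + u * d * a + u * a' * u)
        - β • (a * u * d + u * a * d + u * u * a')
        - γ • a)
  map_add' x y := by
    ext
    · simp only [Pi.add_apply, Prod.fst_add, mul_add, add_mul, smul_add]
      abel
    · simp only [Pi.add_apply, Prod.snd_add, mul_add, add_mul, smul_add]
      abel
  map_smul' c x := by
    ext <;>
      simp only [Pi.smul_apply, Prod.smul_fst, Prod.smul_snd, RingHom.id_apply, smul_sub, smul_add,
        mul_smul_comm, smul_mul_assoc, smul_comm c]

/-- `1`-cocycles of the complex. -/
abbrev KoszulZ1 (α β γ : K) : Submodule K (Gen → Alg α β γ) := LinearMap.ker (koszulD1 α β γ)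

/-- `1`-coboundaries of the complex. -/
abbrev KoszulB1 (α β γ : K) : Submodule K (Gen → Alg α β γ) := LinearMap.range (koszulD0 α β γ)

/-- The first cohomology space of the complex, `Ker d₁* / Im d₀*`. -/
abbrev KoszulH1 (α β γ : K) : Type _ :=
  KoszulZ1 α β γ ⧸ (KoszulB1 α β γ).submoduleOf (KoszulZ1 α β γ)

theorem koszul_mem_of_derivation (α β γ : K) {f : Alg α β γ →ₗ[K] Alg α β γ}
    (hf : f ∈ HochschildZ1 K (Alg α β γ)) :
    (fun g => f (gen α β γ g)) ∈ KoszulZ1 α β γ := by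
  have L := hochschildZ1_leibniz K (Alg α β γ) hf
  have h1 := congrArg f (gen_ddu α β γ)
  have h2 := congrArg f (gen_duu α β γ)
  simp only [map_add, map_smul, L, add_mul] at h1 h2
  rw [LinearMap.mem_ker]
  refine Prod.ext ?_ ?_
  · change _ - _ - _ - _ = _
    simp only [Prod.fst_zero]
    rw [sub_sub, sub_sub, sub_eq_zero]
    convert h1 using 1
    · abel
    · simp only [smul_add]
      abel
  · change _ - _ - _ - _ = _
    simp only [Prod.snd_zero]
    rw [sub_sub, sub_sub, sub_eq_zero]
    convert h2 using 1
    · abel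
    · simp only [smul_add]
      abel

/-- Restriction of Hochschild `1`-cocycles to the generators: `f ↦ D|f(d) + U|f(u)`. -/
def restrictZ1 (α β γ : K) : HochschildZ1 K (Alg α β γ) →ₗ[K] KoszulZ1 α β γ where
  toFun f := ⟨fun g => f.1 (gen α β γ g), koszul_mem_of_derivation α β γ f.2⟩
  map_add' _ _ := rfl
  map_smul' _ _ := rfl

/-- The canonical comparison map from `HH¹(A)` to the first cohomology space of the complex,
induced by restriction to the generators. -/
def comparison (α β γ : K) : HochschildHH1 K (Alg α β γ) →ₗ[K] KoszulH1 α β γ :=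
  Submodule.mapQ _ _ (restrictZ1 α β γ) (by
    rintro ⟨f, hf⟩ ⟨a, rfl⟩
    exact ⟨a, rfl⟩)

/-- The element `D|d` (for `g = d`), respectively `U|u` (for `g = u`), of `V* ⊗ A`. -/
def koszulEuler (α β γ : K) (g : Gen) : Gen → Alg α β γ := Pi.single g (gen α β γ g)

end DownUp

/-!
# The first Hochschild cohomology of a graded generic down-up algebra

A derivation of `A = A(α, β, 0)` is determined by its values on `d` and `u`, and any pair of values
satisfying the linearised relations extends, as the infinitesimal part of an algebra map to the dual
numbers over `A` (`restrictZ1_surjective`). Hence `HH¹(A)` is the cohomology of the small complex,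
and the point is that each of its cocycles is a coboundary plus a combination of `D|d` and `U|u`.

The statement descends from an extension `L` of `K` to `K` along a `K`-linear retraction `L → K`
(`exists_retraction`), so let `α = q + r` and `β = -qr`. With `z = du - r ud` the relations become
`dz = q zd`, `zu = q uz`, `du = r ud + z`, and the monomials `uⁱ zʲ dᵏ` form a basis
(`coord_expand`, `expand_coord`). This is uniform in `α` and `β`, including `β = 0`. The roots
are labelled such that `q ≠ 0` and `rⁿ ≠ q` for all `n ≥ 2`
(`IsGradedGeneric.exists_goodRoots`).

Give `uⁱ zʲ dᵏ` the weight `k - i`. The commutator with `z` multiplies this monomial by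
`(qⁱ - qᵏ) z`, where `q` is not a root of unity. For a derivation `δ`, the part of `δ(z)` of nonzero
weight is divisible by `z`, because modulo `z` the relations force `rⁱ = q = rᵏ` on its
coefficients. So an inner derivation removes that part (`IsCocycle.exists_nzValue_sub_mem`), and
then `δ` has weight zero by the relations between `z` and `d`, `u`. On weight zero, the commutator
with `d` reaches everything of weight one except `d` itself (`exists_dn_commutator_eq`), since it
is triangular with diagonal entries `rⁱ qʲ - 1`. Once `δ(d) = 0` and `δ(u)` has no
term `u`, the equation `d δ(z) = q δ(z) d` gives `δ(z) = 0`, and then `d δ(u) = r δ(u) d` gives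
`δ(u) = 0` (`snd_eq_zero`).
-/

namespace DownUp

/-! ### The universal property -/

section Lift

variable {K : Type*} [Field K] (α β γ : K) {B : Type*} [Ring B] [Algebra K B]

/-- The universal property of the down-up algebra. -/
noncomputable def lift (f : Gen → B)
    (h₁ : f Gen.d * f Gen.d * f Gen.u = α • (f Gen.d * f Gen.u * f Gen.d)
      + β • (f Gen.u * f Gen.d * f Gen.d) + γ • f Gen.d)
    (h₂ : f Gen.d * f Gen.u * f Gen.u = α • (f Gen.u * f Gen.d * f Gen.u)
      + β • (f Gen.u * f Gen.u * f Gen.d) + γ • f Gen.u) :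
    Alg α β γ →ₐ[K] B :=
  RingQuot.liftAlgHom K ⟨FreeAlgebra.lift K f, by
    intro x y h
    cases h <;>
      simpa only [map_mul, map_add, map_smul, FreeAlgebra.lift_ι_apply]⟩

theorem lift_gen (f : Gen → B) (h₁ h₂) (g : Gen) : lift α β γ f h₁ h₂ (gen α β γ g) = f g := by
  rw [lift, gen, RingQuot.liftAlgHom_mkAlgHom_apply, FreeAlgebra.lift_ι_apply]

variable {α β γ} in
@[elab_as_elim]
theorem Alg.induction {P : Alg α β γ → Prop} (algebraMap : ∀ c : K, P (algebraMap K _ c))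
    (gen : ∀ g, P (gen α β γ g)) (mul : ∀ a b, P a → P b → P (a * b))
    (add : ∀ a b, P a → P b → P (a + b)) (a : Alg α β γ) : P a := by
  obtain ⟨a, rfl⟩ := RingQuot.mkAlgHom_surjective K _ a
  induction a using FreeAlgebra.induction with
  | grade0 c => rw [AlgHom.commutes]; exact algebraMap c
  | grade1 g => exact gen g
  | mul a b ha hb => rw [map_mul]; exact mul _ _ ha hb
  | add a b ha hb => rw [map_add]; exact add _ _ ha hb

end Lift

/-! ### Down-up algebras over a field containing the roots -/

section Split

variable {K : Type*} [Field K] (q r : K)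

/-- The two-parameter integer `[n] = ∑ qᵃ rᵇ` over `a + b = n - 1`; it is the coefficient in
`d uⁿ = rⁿ uⁿ d + [n] uⁿ⁻¹ z`. -/
def qrInt : ℕ → K
  | 0 => 0
  | n + 1 => r ^ n + q * qrInt n

theorem qrInt_zero : qrInt q r 0 = 0 := rfl

theorem qrInt_succ (n : ℕ) : qrInt q r (n + 1) = r ^ n + q * qrInt q r n := rfl

theorem qrInt_succ' (n : ℕ) : qrInt q r (n + 1) = q ^ n + r * qrInt q r n := by
  induction n with
  | zero => simp [qrInt]
  | succ n ih =>
    rw [qrInt_succ q r (n + 1)]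
    linear_combination q * ih - r * qrInt_succ q r n

/-- The down-up algebra whose characteristic polynomial `t² - α t - β` has the roots
`q` and `r`. -/
abbrev SplitAlg : Type _ := Alg (q + r) (-(q * r)) 0

/-- The generator `d`. -/
noncomputable abbrev dn : SplitAlg q r := gen (q + r) (-(q * r)) 0 Gen.d

/-- The generator `u`. -/
noncomputable abbrev up : SplitAlg q r := gen (q + r) (-(q * r)) 0 Gen.u

/-- The normal element `z = du - r ud`, which commutes with `d` and `u` up to powers of `q`. -/
noncomputable def nz : SplitAlg q r := dn q r * up q r - r • (up q r * dn q r)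

theorem dn_mul_up : dn q r * up q r = r • (up q r * dn q r) + nz q r := by
  rw [nz]; abel

theorem dn_mul_nz : dn q r * nz q r = q • (nz q r * dn q r) := by
  have h := gen_ddu (q + r) (-(q * r)) 0
  simp only [nz, mul_sub, sub_mul, mul_smul_comm, smul_mul_assoc, ← mul_assoc] at h ⊢
  rw [h]
  module

theorem nz_mul_up : nz q r * up q r = q • (up q r * nz q r) := by
  have h := gen_duu (q + r) (-(q * r)) 0
  simp only [nz, mul_sub, sub_mul, mul_smul_comm, smul_mul_assoc, ← mul_assoc] at h ⊢
  rw [h]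
  module

theorem nz_mul_up_pow (i : ℕ) : nz q r * up q r ^ i = q ^ i • (up q r ^ i * nz q r) := by
  induction i with
  | zero => simp
  | succ i ih =>
    rw [pow_succ, ← mul_assoc, ih, smul_mul_assoc, mul_assoc, nz_mul_up, mul_smul_comm, smul_smul,
      mul_assoc, pow_succ]

theorem nz_pow_mul_up (j : ℕ) : nz q r ^ j * up q r = q ^ j • (up q r * nz q r ^ j) := by
  induction j with
  | zero => simp
  | succ i ih =>
    rw [pow_succ', mul_assoc, ih, mul_smul_comm, ← mul_assoc, nz_mul_up, smul_mul_assoc, smul_smul,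
      mul_assoc, pow_succ]

theorem dn_mul_nz_pow (j : ℕ) : dn q r * nz q r ^ j = q ^ j • (nz q r ^ j * dn q r) := by
  induction j with
  | zero => simp
  | succ i ih =>
    rw [pow_succ, ← mul_assoc, ih, smul_mul_assoc, mul_assoc, dn_mul_nz, mul_smul_comm, smul_smul,
      mul_assoc, pow_succ]

theorem dn_pow_mul_nz (k : ℕ) : dn q r ^ k * nz q r = q ^ k • (nz q r * dn q r ^ k) := by
  induction k with
  | zero => simp
  | succ i ih =>
    rw [pow_succ', mul_assoc, ih, mul_smul_comm, ← mul_assoc, dn_mul_nz, smul_mul_assoc, smul_smul,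
      mul_assoc, pow_succ]

theorem dn_mul_up_pow (i : ℕ) : dn q r * up q r ^ i
    = r ^ i • (up q r ^ i * dn q r) + qrInt q r i • (up q r ^ (i - 1) * nz q r) := by
  induction i with
  | zero => simp [qrInt]
  | succ i ih =>
    have h : qrInt q r i • (up q r ^ (i - 1) * nz q r * up q r)
        = (q * qrInt q r i) • (up q r ^ i * nz q r) := by
      cases i with
      | zero => simp [qrInt]
      | succ i =>
        rw [mul_assoc, nz_mul_up, mul_smul_comm, smul_smul, mul_comm (qrInt q r _),
          Nat.add_sub_cancel, pow_succ (up q r), mul_assoc]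
    rw [pow_succ, ← mul_assoc, ih, add_mul, smul_mul_assoc, smul_mul_assoc, h, mul_assoc, dn_mul_up,
      mul_add, mul_smul_comm, Nat.add_sub_cancel, qrInt_succ, ← mul_assoc]
    module

theorem dn_pow_mul_up (k : ℕ) : dn q r ^ k * up q r
    = r ^ k • (up q r * dn q r ^ k) + qrInt q r k • (nz q r * dn q r ^ (k - 1)) := by
  induction k with
  | zero => simp [qrInt]
  | succ i ih =>
    have h : qrInt q r i • (dn q r * (nz q r * dn q r ^ (i - 1)))
        = (q * qrInt q r i) • (nz q r * dn q r ^ i) := by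
      cases i with
      | zero => simp [qrInt]
      | succ i =>
        rw [← mul_assoc, dn_mul_nz, smul_mul_assoc, smul_smul, mul_comm (qrInt q r _),
          Nat.add_sub_cancel, pow_succ' (dn q r), mul_assoc]
    rw [pow_succ', mul_assoc, ih, mul_add, mul_smul_comm, mul_smul_comm, h, ← mul_assoc, dn_mul_up,
      add_mul, smul_mul_assoc, Nat.add_sub_cancel, qrInt_succ, mul_assoc]
    module

/-- The ordered monomial `uⁱ zʲ dᵏ`. -/
noncomputable def mono (i j k : ℕ) : SplitAlg q r := up q r ^ i * nz q r ^ j * dn q r ^ k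

theorem up_mul_mono (i j k : ℕ) : up q r * mono q r i j k = mono q r (i + 1) j k := by
  simp only [mono, pow_succ', mul_assoc]

theorem mono_mul_dn (i j k : ℕ) : mono q r i j k * dn q r = mono q r i j (k + 1) := by
  simp only [mono, pow_succ, mul_assoc]

theorem nz_mul_mono (i j k : ℕ) :
    nz q r * mono q r i j k = q ^ i • mono q r i (j + 1) k := by
  simp only [mono]
  rw [← mul_assoc, ← mul_assoc, nz_mul_up_pow, pow_succ' (nz q r)]
  simp only [smul_mul_assoc, mul_assoc]

theorem mono_mul_nz (i j k : ℕ) :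
    mono q r i j k * nz q r = q ^ k • mono q r i (j + 1) k := by
  simp only [mono]
  rw [mul_assoc, dn_pow_mul_nz, pow_succ (nz q r)]
  simp only [mul_smul_comm, mul_assoc]

theorem dn_mul_mono (i j k : ℕ) : dn q r * mono q r i j k
    = (r ^ i * q ^ j) • mono q r i j (k + 1)
      + qrInt q r i • mono q r (i - 1) (j + 1) k := by
  simp only [mono]
  rw [← mul_assoc, ← mul_assoc, dn_mul_up_pow, add_mul, add_mul, smul_mul_assoc,
    mul_assoc _ (dn q r), dn_mul_nz_pow, pow_succ' (nz q r), pow_succ' (dn q r)]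
  simp only [smul_mul_assoc, mul_smul_comm, mul_assoc, smul_smul]

theorem mono_mul_up (i j k : ℕ) : mono q r i j k * up q r
    = (r ^ k * q ^ j) • mono q r (i + 1) j k
      + qrInt q r k • mono q r i (j + 1) (k - 1) := by
  simp only [mono]
  rw [mul_assoc, dn_pow_mul_up, mul_add, mul_smul_comm, ← mul_assoc, mul_assoc _ _ (up q r),
    nz_pow_mul_up, pow_succ (nz q r), pow_succ (up q r)]
  simp only [smul_mul_assoc, mul_smul_comm, mul_assoc, smul_smul]

/-! ### The monomials `uⁱ zʲ dᵏ` form a basis -/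

/-- The free module on the exponents of the monomials `uⁱ zʲ dᵏ`. -/
abbrev MonoSpace (K : Type*) [Field K] : Type _ := (ℕ × ℕ × ℕ) →₀ K

/-- The basis vector standing for `uⁱ zʲ dᵏ`. -/
noncomputable abbrev ev (K : Type*) [Field K] (i j k : ℕ) : MonoSpace K :=
  Finsupp.single (i, j, k) 1

/-- Left multiplication by a generator, as it has to be on `MonoSpace K`. The truncated
exponent `i - 1` at `i = 0` is harmless since `[0] = 0`. -/
noncomputable def leftMul : Gen → Module.End K (MonoSpace K)
  | Gen.d => Finsupp.linearCombination K fun t =>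
      (r ^ t.1 * q ^ t.2.1) • ev K t.1 t.2.1 (t.2.2 + 1)
        + qrInt q r t.1 • ev K (t.1 - 1) (t.2.1 + 1) t.2.2
  | Gen.u => Finsupp.linearCombination K fun t => ev K (t.1 + 1) t.2.1 t.2.2

theorem leftMul_d_ev (i j k : ℕ) : leftMul q r Gen.d (ev K i j k)
    = (r ^ i * q ^ j) • ev K i j (k + 1) + qrInt q r i • ev K (i - 1) (j + 1) k := by
  rw [leftMul, Finsupp.linearCombination_single, one_smul]

theorem leftMul_u_ev (i j k : ℕ) : leftMul q r Gen.u (ev K i j k) = ev K (i + 1) j k := by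
  rw [leftMul, Finsupp.linearCombination_single, one_smul]

/-- Left multiplication by `z` on `MonoSpace K`. -/
noncomputable def leftMulNz : Module.End K (MonoSpace K) :=
  leftMul q r Gen.d * leftMul q r Gen.u - r • (leftMul q r Gen.u * leftMul q r Gen.d)

theorem leftMulNz_ev (i j k : ℕ) : leftMulNz q r (ev K i j k) = q ^ i • ev K i (j + 1) k := by
  have h : qrInt q r i • ev K (i - 1 + 1) (j + 1) k = qrInt q r i • ev K i (j + 1) k := by
    cases i <;> simp [qrInt_zero]
  simp only [leftMulNz, LinearMap.sub_apply, LinearMap.smul_apply, Module.End.mul_apply,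
    leftMul_u_ev, leftMul_d_ev, map_add, map_smul, h, Nat.add_sub_cancel, qrInt_succ']
  module

theorem leftMul_d_mul_leftMulNz :
    leftMul q r Gen.d * leftMulNz q r = q • (leftMulNz q r * leftMul q r Gen.d) := by
  refine Finsupp.lhom_ext' fun ⟨i, j, k⟩ => LinearMap.ext_ring ?_
  change leftMul q r Gen.d (leftMulNz q r (ev K i j k))
    = q • leftMulNz q r (leftMul q r Gen.d (ev K i j k))
  rw [leftMulNz_ev, map_smul, leftMul_d_ev, leftMul_d_ev, map_add, map_smul, map_smul,
    leftMulNz_ev, leftMulNz_ev]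
  cases i with
  | zero => simp only [qrInt_zero]; module
  | succ i => rw [Nat.add_sub_cancel]; module

theorem leftMulNz_mul_leftMul_u :
    leftMulNz q r * leftMul q r Gen.u = q • (leftMul q r Gen.u * leftMulNz q r) := by
  refine Finsupp.lhom_ext' fun ⟨i, j, k⟩ => LinearMap.ext_ring ?_
  change leftMulNz q r (leftMul q r Gen.u (ev K i j k))
    = q • leftMul q r Gen.u (leftMulNz q r (ev K i j k))
  rw [leftMulNz_ev, map_smul, leftMul_u_ev, leftMul_u_ev, leftMulNz_ev]
  module

/-- The action of the algebra on `MonoSpace K` by left multiplication. -/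
noncomputable def leftRep : SplitAlg q r →ₐ[K] Module.End K (MonoSpace K) :=
  lift (q + r) (-(q * r)) 0 (leftMul q r)
    (by
      have h := leftMul_d_mul_leftMulNz q r
      simp only [leftMulNz, mul_sub, sub_mul, mul_smul_comm, smul_mul_assoc, ← mul_assoc] at h
      rw [sub_eq_iff_eq_add] at h
      rw [h]
      module)
    (by
      have h := leftMulNz_mul_leftMul_u q r
      simp only [leftMulNz, mul_sub, sub_mul, mul_smul_comm, smul_mul_assoc, ← mul_assoc] at h
      rw [sub_eq_iff_eq_add] at h
      rw [h]
      module)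

theorem leftRep_gen (g : Gen) : leftRep q r (gen _ _ 0 g) = leftMul q r g :=
  lift_gen ..

/-- The coefficients of an element with respect to the monomials `uⁱ zʲ dᵏ`. -/
noncomputable def coord : SplitAlg q r →ₗ[K] MonoSpace K :=
  (LinearMap.applyₗ (ev K 0 0 0)).comp (leftRep q r).toLinearMap

theorem coord_def (a : SplitAlg q r) : coord q r a = leftRep q r a (ev K 0 0 0) := rfl

/-- The element with given coefficients. -/
noncomputable def expand : MonoSpace K →ₗ[K] SplitAlg q r :=
  Finsupp.linearCombination K fun t => mono q r t.1 t.2.1 t.2.2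

theorem expand_ev (i j k : ℕ) : expand q r (ev K i j k) = mono q r i j k := by
  rw [expand, Finsupp.linearCombination_single, one_smul]

/-- `leftMul` is left multiplication, seen through `expand`. -/
theorem expand_leftMul (g : Gen) (m : MonoSpace K) :
    expand q r (leftMul q r g m) = gen _ _ 0 g * expand q r m := by
  suffices h : (expand q r).comp (leftMul q r g)
      = (LinearMap.mulLeft K (gen _ _ 0 g)).comp (expand q r) from LinearMap.congr_fun h m
  refine Finsupp.lhom_ext' fun ⟨i, j, k⟩ => LinearMap.ext_ring ?_
  change expand q r (leftMul q r g (ev K i j k)) = gen _ _ 0 g * expand q r (ev K i j k)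
  cases g
  · rw [leftMul_d_ev, map_add, map_smul, map_smul, expand_ev, expand_ev, expand_ev, dn_mul_mono]
  · rw [leftMul_u_ev, expand_ev, expand_ev, up_mul_mono]

theorem expand_leftRep (a : SplitAlg q r) (m : MonoSpace K) :
    expand q r (leftRep q r a m) = a * expand q r m := by
  induction a using Alg.induction generalizing m with
  | algebraMap c => simp [Algebra.algebraMap_eq_smul_one]
  | gen g => rw [leftRep_gen, expand_leftMul]
  | mul a b ha hb => rw [map_mul, Module.End.mul_apply, ha, hb, mul_assoc]
  | add a b ha hb => rw [map_add, LinearMap.add_apply, map_add, ha, hb, add_mul]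

theorem expand_coord (a : SplitAlg q r) : expand q r (coord q r a) = a := by
  rw [coord_def, expand_leftRep, expand_ev]
  simp [mono]

theorem coord_mono (i j k : ℕ) : coord q r (mono q r i j k) = ev K i j k := by
  have hz : leftRep q r (nz q r) = leftMulNz q r := by
    simp only [nz, leftMulNz, map_sub, map_mul, map_smul, leftRep_gen]
  have hd : leftRep q r (dn q r ^ k) (ev K 0 0 0) = ev K 0 0 k := by
    induction k with
    | zero => simp
    | succ k ih =>
      rw [pow_succ', map_mul, Module.End.mul_apply, ih, leftRep_gen, leftMul_d_ev]
      simp [qrInt_zero]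
  have hj : leftRep q r (nz q r ^ j) (ev K 0 0 k) = ev K 0 j k := by
    induction j with
    | zero => simp
    | succ j ih =>
      rw [pow_succ', map_mul, Module.End.mul_apply, ih, hz, leftMulNz_ev]
      simp
  have hi : leftRep q r (up q r ^ i) (ev K 0 j k) = ev K i j k := by
    induction i with
    | zero => simp
    | succ i ih =>
      rw [pow_succ', map_mul, Module.End.mul_apply, ih, leftRep_gen, leftMul_u_ev]
  rw [coord_def, mono, map_mul, map_mul, Module.End.mul_apply, Module.End.mul_apply, hd, hj, hi]

theorem coord_expand (m : MonoSpace K) : coord q r (expand q r m) = m := by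
  suffices h : (coord q r).comp (expand q r) = LinearMap.id from LinearMap.congr_fun h m
  refine Finsupp.lhom_ext' fun ⟨i, j, k⟩ => LinearMap.ext_ring ?_
  change coord q r (expand q r (ev K i j k)) = ev K i j k
  rw [expand_ev, coord_mono]

theorem linearMap_ext_mono {N : Type*} [AddCommGroup N] [Module K N] {f g : SplitAlg q r →ₗ[K] N}
    (h : ∀ i j k, f (mono q r i j k) = g (mono q r i j k)) : f = g := by
  have h' : f.comp (expand q r) = g.comp (expand q r) := by
    refine Finsupp.lhom_ext' fun ⟨i, j, k⟩ => LinearMap.ext_ring ?_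
    change f (expand q r (ev K i j k)) = g (expand q r (ev K i j k))
    rw [expand_ev, h]
  ext a
  simpa [expand_coord] using LinearMap.congr_fun h' (coord q r a)

/-- The coefficient of `uⁱ zʲ dᵏ`. -/
noncomputable def co (i j k : ℕ) : SplitAlg q r →ₗ[K] K :=
  (Finsupp.lapply (i, j, k)).comp (coord q r)

theorem co_mono (i j k i' j' k' : ℕ) :
    co q r i j k (mono q r i' j' k') = if i' = i ∧ j' = j ∧ k' = k then 1 else 0 := by
  simp [co, coord_mono, Finsupp.single_apply]

theorem co_ext {a b : SplitAlg q r} (h : ∀ i j k, co q r i j k a = co q r i j k b) : a = b := by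
  rw [← expand_coord q r a, ← expand_coord q r b]
  congr 1
  ext ⟨i, j, k⟩
  exact h i j k

end Split

/-! ### Coefficients of products -/

section Coefficients

variable {K : Type*} [Field K] (q r : K)

theorem co_up_mul_zero (j k : ℕ) (a : SplitAlg q r) : co q r 0 j k (up q r * a) = 0 := by
  refine LinearMap.congr_fun (f := (co q r 0 j k).comp (LinearMap.mulLeft K (up q r))) (g := 0)
    (linearMap_ext_mono q r fun i' j' k' => ?_) a
  simp [up_mul_mono, co_mono]

theorem co_up_mul_succ (i j k : ℕ) (a : SplitAlg q r) :
    co q r (i + 1) j k (up q r * a) = co q r i j k a := by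
  refine LinearMap.congr_fun (f := (co q r (i + 1) j k).comp (LinearMap.mulLeft K (up q r)))
    (linearMap_ext_mono q r fun i' j' k' => ?_) a
  simp [up_mul_mono, co_mono]

theorem co_mul_dn_zero (i j : ℕ) (a : SplitAlg q r) : co q r i j 0 (a * dn q r) = 0 := by
  refine LinearMap.congr_fun (f := (co q r i j 0).comp (LinearMap.mulRight K (dn q r))) (g := 0)
    (linearMap_ext_mono q r fun i' j' k' => ?_) a
  simp [mono_mul_dn, co_mono]

theorem co_mul_dn_succ (i j k : ℕ) (a : SplitAlg q r) :
    co q r i j (k + 1) (a * dn q r) = co q r i j k a := by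
  refine LinearMap.congr_fun (f := (co q r i j (k + 1)).comp (LinearMap.mulRight K (dn q r)))
    (linearMap_ext_mono q r fun i' j' k' => ?_) a
  simp [mono_mul_dn, co_mono]

theorem co_nz_mul_zero (i k : ℕ) (a : SplitAlg q r) : co q r i 0 k (nz q r * a) = 0 := by
  refine LinearMap.congr_fun (f := (co q r i 0 k).comp (LinearMap.mulLeft K (nz q r))) (g := 0)
    (linearMap_ext_mono q r fun i' j' k' => ?_) a
  simp [nz_mul_mono, co_mono]

theorem co_nz_mul_succ (i j k : ℕ) (a : SplitAlg q r) :
    co q r i (j + 1) k (nz q r * a) = q ^ i * co q r i j k a := by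
  refine LinearMap.congr_fun (f := (co q r i (j + 1) k).comp (LinearMap.mulLeft K (nz q r)))
    (g := q ^ i • co q r i j k) (linearMap_ext_mono q r fun i' j' k' => ?_) a
  simp +contextual [nz_mul_mono, co_mono]

theorem co_mul_nz_zero (i k : ℕ) (a : SplitAlg q r) : co q r i 0 k (a * nz q r) = 0 := by
  refine LinearMap.congr_fun (f := (co q r i 0 k).comp (LinearMap.mulRight K (nz q r))) (g := 0)
    (linearMap_ext_mono q r fun i' j' k' => ?_) a
  simp [mono_mul_nz, co_mono]

theorem co_mul_nz_succ (i j k : ℕ) (a : SplitAlg q r) :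
    co q r i (j + 1) k (a * nz q r) = q ^ k * co q r i j k a := by
  refine LinearMap.congr_fun (f := (co q r i (j + 1) k).comp (LinearMap.mulRight K (nz q r)))
    (g := q ^ k • co q r i j k) (linearMap_ext_mono q r fun i' j' k' => ?_) a
  simp +contextual [mono_mul_nz, co_mono]

theorem co_dn_mul_zero_succ (i k : ℕ) (a : SplitAlg q r) :
    co q r i 0 (k + 1) (dn q r * a) = r ^ i * co q r i 0 k a := by
  refine LinearMap.congr_fun (f := (co q r i 0 (k + 1)).comp (LinearMap.mulLeft K (dn q r)))
    (g := r ^ i • co q r i 0 k) (linearMap_ext_mono q r fun i' j' k' => ?_) a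
  simp +contextual [dn_mul_mono, co_mono]

theorem co_dn_mul_succ_zero (i j : ℕ) (a : SplitAlg q r) :
    co q r i (j + 1) 0 (dn q r * a) = qrInt q r (i + 1) * co q r (i + 1) j 0 a := by
  refine LinearMap.congr_fun (f := (co q r i (j + 1) 0).comp (LinearMap.mulLeft K (dn q r)))
    (g := qrInt q r (i + 1) • co q r (i + 1) j 0) (linearMap_ext_mono q r fun i' j' k' => ?_) a
  cases i' with
  | zero => simp [dn_mul_mono, co_mono, qrInt_zero]
  | succ i' => simp +contextual [dn_mul_mono, co_mono]

theorem co_dn_mul_succ_succ (i j k : ℕ) (a : SplitAlg q r) :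
    co q r i (j + 1) (k + 1) (dn q r * a)
      = r ^ i * q ^ (j + 1) * co q r i (j + 1) k a
        + qrInt q r (i + 1) * co q r (i + 1) j (k + 1) a := by
  refine LinearMap.congr_fun (f := (co q r i (j + 1) (k + 1)).comp (LinearMap.mulLeft K (dn q r)))
    (g := (r ^ i * q ^ (j + 1)) • co q r i (j + 1) k
      + qrInt q r (i + 1) • co q r (i + 1) j (k + 1))
    (linearMap_ext_mono q r fun i' j' k' => ?_) a
  cases i' with
  | zero =>
    simp [dn_mul_mono, co_mono, qrInt_zero]
    split_ifs with h
    · simp [← h.1, h.2.1]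
    · rfl
  | succ i' =>
    simp [dn_mul_mono, co_mono]
    congr 1 <;> split_ifs <;> simp_all

theorem co_mul_up_succ_zero (i k : ℕ) (a : SplitAlg q r) :
    co q r (i + 1) 0 k (a * up q r) = r ^ k * co q r i 0 k a := by
  refine LinearMap.congr_fun (f := (co q r (i + 1) 0 k).comp (LinearMap.mulRight K (up q r)))
    (g := r ^ k • co q r i 0 k) (linearMap_ext_mono q r fun i' j' k' => ?_) a
  simp +contextual [mono_mul_up, co_mono]

theorem co_mul_up_zero_succ (j k : ℕ) (a : SplitAlg q r) :
    co q r 0 (j + 1) k (a * up q r) = qrInt q r (k + 1) * co q r 0 j (k + 1) a := by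
  refine LinearMap.congr_fun (f := (co q r 0 (j + 1) k).comp (LinearMap.mulRight K (up q r)))
    (g := qrInt q r (k + 1) • co q r 0 j (k + 1)) (linearMap_ext_mono q r fun i' j' k' => ?_) a
  cases k' with
  | zero => simp [mono_mul_up, co_mono, qrInt_zero]
  | succ k' => simp +contextual [mono_mul_up, co_mono]

theorem co_mul_up_succ_succ (i j k : ℕ) (a : SplitAlg q r) :
    co q r (i + 1) (j + 1) k (a * up q r)
      = r ^ k * q ^ (j + 1) * co q r i (j + 1) k a
        + qrInt q r (k + 1) * co q r (i + 1) j (k + 1) a := by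
  refine LinearMap.congr_fun (f := (co q r (i + 1) (j + 1) k).comp (LinearMap.mulRight K (up q r)))
    (g := (r ^ k * q ^ (j + 1)) • co q r i (j + 1) k
      + qrInt q r (k + 1) • co q r (i + 1) j (k + 1))
    (linearMap_ext_mono q r fun i' j' k' => ?_) a
  cases k' with
  | zero =>
    simp [mono_mul_up, co_mono, qrInt_zero]
    split_ifs with h
    · simp [← h.2.2, h.2.1]
    · rfl
  | succ k' =>
    simp [mono_mul_up, co_mono]
    congr 1 <;> split_ifs <;> simp_all

end Coefficients

/-! ### Cocycles over a field containing the roots -/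

section Cocycles

variable {K : Type*} [Field K] (q r : K)

/-- A labelling of the roots of `t² - α t - β` for which the argument works: no nontrivial
monomial in the roots is `1`, the root `q` is nonzero, and it is no higher power of `r`. -/
structure GoodRoots : Prop where
  ne_zero : q ≠ 0
  pow_mul_pow_ne_one : ∀ i j : ℕ, (i, j) ≠ (0, 0) → r ^ i * q ^ j ≠ 1
  pow_ne : ∀ n : ℕ, 2 ≤ n → r ^ n ≠ q

/-- The value `δ(z) = δ(d) u + d δ(u) - r (δ(u) d + u δ(d))` at `z = du - r ud` of the derivation
with `δ(d) = p` and `δ(u) = s`. -/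
noncomputable def nzValue (p s : SplitAlg q r) : SplitAlg q r :=
  p * up q r + dn q r * s - r • (s * dn q r + up q r * p)

/-- The condition on `p`, `s` that the relations `d z = q z d` and `z u = q u z` are respected
by `d ↦ p`, `u ↦ s`. -/
structure IsCocycle (p s : SplitAlg q r) : Prop where
  dn_nz : p * nz q r + dn q r * nzValue q r p s = q • (nzValue q r p s * dn q r + nz q r * p)
  nz_up : nzValue q r p s * up q r + nz q r * s = q • (up q r * nzValue q r p s + s * nz q r)

variable {q r}

theorem GoodRoots.pow_ne_pow (h : GoodRoots q r) {m n : ℕ} (hmn : m ≠ n) : q ^ m ≠ q ^ n := by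
  wlog hlt : m < n generalizing m n
  · exact (this hmn.symm (by omega)).symm
  obtain ⟨c, rfl⟩ := Nat.exists_eq_add_of_lt hlt
  intro h'
  rw [add_assoc, pow_add] at h'
  have := mul_left_cancel₀ (pow_ne_zero m h.ne_zero) ((mul_one _).trans h')
  exact h.pow_mul_pow_ne_one 0 (c + 1) (by simp) (by simpa using this.symm)

theorem nzValue_sub (p p' s s' : SplitAlg q r) :
    nzValue q r (p - p') (s - s') = nzValue q r p s - nzValue q r p' s' := by
  simp only [nzValue, sub_mul, mul_sub, smul_add, smul_sub]
  abel

theorem IsCocycle.sub {p p' s s' : SplitAlg q r} (h : IsCocycle q r p s)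
    (h' : IsCocycle q r p' s') : IsCocycle q r (p - p') (s - s') := by
  constructor
  · have e := congrArg₂ (· - ·) h.dn_nz h'.dn_nz
    simp only [← smul_sub] at e
    rw [nzValue_sub]
    convert e using 1
    · noncomm_ring
    · congr 1; noncomm_ring
  · have e := congrArg₂ (· - ·) h.nz_up h'.nz_up
    simp only [← smul_sub] at e
    rw [nzValue_sub]
    convert e using 1
    · noncomm_ring
    · congr 1; noncomm_ring

/-- An inner derivation maps `z` to a commutator with `z`. -/
theorem nzValue_inner (a : SplitAlg q r) :
    nzValue q r (dn q r * a - a * dn q r) (up q r * a - a * up q r) = nz q r * a - a * nz q r := by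
  simp only [nzValue, nz, sub_mul, mul_sub, smul_add, smul_sub, mul_assoc, smul_mul_assoc,
    mul_smul_comm]
  abel

theorem isCocycle_inner (a : SplitAlg q r) :
    IsCocycle q r (dn q r * a - a * dn q r) (up q r * a - a * up q r) := by
  constructor
  · have h := dn_mul_nz q r
    rw [nzValue_inner]
    have e := congrArg (fun x => x * a - a * x) h
    simp only [mul_smul_comm, smul_mul_assoc, ← smul_sub] at e
    convert e using 1
    · noncomm_ring
    · congr 1; noncomm_ring
  · have h := nz_mul_up q r
    rw [nzValue_inner]
    have e := congrArg (fun x => x * a - a * x) h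
    simp only [mul_smul_comm, smul_mul_assoc, ← smul_sub] at e
    convert e using 1
    · noncomm_ring
    · congr 1; noncomm_ring

theorem nzValue_euler (c e : K) : nzValue q r (c • dn q r) (e • up q r) = (c + e) • nz q r := by
  simp only [nzValue, nz, smul_mul_assoc, mul_smul_comm]
  module

theorem isCocycle_euler (c e : K) : IsCocycle q r (c • dn q r) (e • up q r) := by
  constructor
  · rw [nzValue_euler]
    simp only [smul_mul_assoc, mul_smul_comm, dn_mul_nz]
    module
  · rw [nzValue_euler]
    simp only [smul_mul_assoc, mul_smul_comm, nz_mul_up]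
    module

/-- The elements of weight zero: combinations of the `uⁱ zʲ dⁱ`. -/
noncomputable def weightZero (q r : K) : Submodule K (SplitAlg q r) where
  carrier := {a | ∀ i j k, i ≠ k → co q r i j k a = 0}
  zero_mem' := by simp
  add_mem' ha hb i j k h := by rw [map_add, ha i j k h, hb i j k h, add_zero]
  smul_mem' c a ha i j k h := by rw [map_smul, ha i j k h, smul_zero]

theorem mono_mem_weightZero (i j : ℕ) : mono q r i j i ∈ weightZero q r := by
  intro i' j' k' h
  rw [co_mono, if_neg]
  omega

theorem nz_mem_weightZero : nz q r ∈ weightZero q r := by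
  simpa [mono] using mono_mem_weightZero (q := q) (r := r) 0 1

theorem nz_commute_of_mem_weightZero {a : SplitAlg q r} (ha : a ∈ weightZero q r) :
    nz q r * a - a * nz q r = 0 := by
  refine co_ext q r fun i j k => ?_
  rw [map_sub, map_zero]
  cases j with
  | zero => rw [co_nz_mul_zero, co_mul_nz_zero, sub_zero]
  | succ j =>
    rw [co_nz_mul_succ, co_mul_nz_succ]
    by_cases h : i = k
    · rw [h, sub_self]
    · rw [ha i j k h, mul_zero, mul_zero, sub_zero]

theorem exists_coord_eq (m : MonoSpace K) :
    ∃ a : SplitAlg q r, ∀ i j k, co q r i j k a = m (i, j, k) :=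
  ⟨expand q r m, fun i j k => by simp [co, coord_expand]⟩

/-- Modulo `z` the algebra is a quantum plane, in which the monomial `uⁱ dᵏ` satisfies the
relations for `δ(z)` only if `rⁱ = q = rᵏ`. -/
theorem IsCocycle.co_nzValue_eq_zero {p s : SplitAlg q r} (hqr : GoodRoots q r)
    (h : IsCocycle q r p s) {i k : ℕ} (hik : i ≠ k) : co q r i 0 k (nzValue q r p s) = 0 := by
  have h1 := congrArg (co q r i 0 (k + 1)) h.dn_nz
  have h2 := congrArg (co q r (i + 1) 0 k) h.nz_up
  simp only [map_add, map_smul, smul_eq_mul, co_mul_nz_zero, co_nz_mul_zero, co_dn_mul_zero_succ,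
    co_mul_dn_succ, co_up_mul_succ, co_mul_up_succ_zero, zero_add, add_zero] at h1 h2
  by_contra hne
  have e1 := mul_right_cancel₀ hne h1
  have e2 := mul_right_cancel₀ hne h2
  have hi : i < 2 := not_le.mp fun hi => hqr.pow_ne i hi e1
  have hk : k < 2 := not_le.mp fun hk => hqr.pow_ne k hk e2
  -- If both exponents are below `2`, one of them is `0`, and `q = 1` is excluded.
  have h01 : i = 0 ∨ k = 0 := by omega
  rcases h01 with rfl | rfl
  · exact hqr.pow_mul_pow_ne_one 0 1 (by simp) (by simpa using e1.symm)
  · exact hqr.pow_mul_pow_ne_one 0 1 (by simp) (by simpa using e2.symm)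

/-- The commutator with `z` multiplies `uⁱ zʲ dᵏ` by `(qⁱ - qᵏ) z`, so the part of `δ(z)` of nonzero
weight, being divisible by `z`, is such a commutator. -/
theorem IsCocycle.exists_nzValue_sub_mem {p s : SplitAlg q r} (hqr : GoodRoots q r)
    (h : IsCocycle q r p s) :
    ∃ a, nzValue q r p s - (nz q r * a - a * nz q r) ∈ weightZero q r := by
  classical
  set w := nzValue q r p s with hw
  -- For `i = k` the coefficient is `0` by division by zero, as it should be.
  obtain ⟨a, ha⟩ := exists_coord_eq (q := q) (r := r) (Finsupp.onFinset
    ((coord q r w).support.image fun t => (t.1, t.2.1 - 1, t.2.2))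
    (fun t => co q r t.1 (t.2.1 + 1) t.2.2 w / (q ^ t.1 - q ^ t.2.2)) (by
      rintro ⟨i, j, k⟩ hne
      refine Finset.mem_image.mpr ⟨(i, j + 1, k), Finsupp.mem_support_iff.mpr ?_, rfl⟩
      exact (div_ne_zero_iff.mp hne).1))
  refine ⟨a, fun i j k hik => ?_⟩
  rw [map_sub, map_sub]
  cases j with
  | zero => rw [co_nz_mul_zero, co_mul_nz_zero, hw, h.co_nzValue_eq_zero hqr hik]; simp
  | succ j =>
    have hne : q ^ i - q ^ k ≠ 0 := sub_ne_zero.mpr (hqr.pow_ne_pow hik)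
    rw [co_nz_mul_succ, co_mul_nz_succ, ha, Finsupp.onFinset_apply]
    field_simp
    ring

/-- If `δ(z)` has weight zero, then comparing coefficients in
`δ(d) z + d δ(z) = q (δ(z) d + z δ(d))` shows that `δ(d)` has weight one. -/
theorem IsCocycle.co_fst_eq_zero {p s : SplitAlg q r} (hqr : GoodRoots q r)
    (h : IsCocycle q r p s) (hw : nzValue q r p s ∈ weightZero q r) {i k : ℕ} (j : ℕ)
    (hik : i + 1 ≠ k) : co q r i j k p = 0 := by
  have h1 := congrArg (co q r i (j + 1) k) h.dn_nz
  have hl : co q r i (j + 1) k (dn q r * nzValue q r p s) = 0 := by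
    cases k with
    | zero => rw [co_dn_mul_succ_zero, hw _ _ _ (by omega), mul_zero]
    | succ k =>
      rw [co_dn_mul_succ_succ, hw _ _ _ (by omega), hw _ _ _ (by omega), mul_zero, mul_zero,
        add_zero]
  have hr : co q r i (j + 1) k (nzValue q r p s * dn q r) = 0 := by
    cases k with
    | zero => rw [co_mul_dn_zero]
    | succ k => rw [co_mul_dn_succ, hw _ _ _ (by omega)]
  rw [map_add, map_smul, map_add, hl, hr, co_mul_nz_succ, co_nz_mul_succ, smul_eq_mul] at h1
  have hne : q ^ k - q ^ (i + 1) ≠ 0 := sub_ne_zero.mpr (hqr.pow_ne_pow hik.symm)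
  refine (mul_eq_zero.mp ?_).resolve_left hne
  linear_combination h1

/-- The counterpart of `IsCocycle.co_fst_eq_zero` for `δ(u)`, which has weight `-1`. -/
theorem IsCocycle.co_snd_eq_zero {p s : SplitAlg q r} (hqr : GoodRoots q r)
    (h : IsCocycle q r p s) (hw : nzValue q r p s ∈ weightZero q r) {i k : ℕ} (j : ℕ)
    (hik : i ≠ k + 1) : co q r i j k s = 0 := by
  have h1 := congrArg (co q r i (j + 1) k) h.nz_up
  have hl : co q r i (j + 1) k (nzValue q r p s * up q r) = 0 := by
    cases i with
    | zero => rw [co_mul_up_zero_succ, hw _ _ _ (by omega), mul_zero]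
    | succ i =>
      rw [co_mul_up_succ_succ, hw _ _ _ (by omega), hw _ _ _ (by omega), mul_zero, mul_zero,
        add_zero]
  have hr : co q r i (j + 1) k (up q r * nzValue q r p s) = 0 := by
    cases i with
    | zero => rw [co_up_mul_zero]
    | succ i => rw [co_up_mul_succ, hw _ _ _ (by omega)]
  rw [map_add, map_smul, map_add, hl, hr, co_mul_nz_succ, co_nz_mul_succ, smul_eq_mul] at h1
  have hne : q ^ i - q ^ (k + 1) ≠ 0 := sub_ne_zero.mpr (hqr.pow_ne_pow hik)
  refine (mul_eq_zero.mp ?_).resolve_left hne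
  linear_combination h1

/-- The commutator with `d` maps `uⁱ zʲ dⁱ` to `(rⁱ qʲ - 1) uⁱ zʲ dⁱ⁺¹` plus a term with a
smaller power of `u`. -/
theorem exists_dn_commutator_eq_mono (hqr : GoodRoots q r) (i j : ℕ) (hij : (i, j) ≠ (0, 0)) :
    ∃ a ∈ weightZero q r, dn q r * a - a * dn q r = mono q r i j (i + 1) := by
  induction i generalizing j with
  | zero =>
    have hne : q ^ j - 1 ≠ 0 := sub_ne_zero.mpr (by simpa using hqr.pow_mul_pow_ne_one 0 j hij)
    refine ⟨(q ^ j - 1)⁻¹ • mono q r 0 j 0, Submodule.smul_mem _ _ (mono_mem_weightZero 0 j), ?_⟩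
    rw [mul_smul_comm, smul_mul_assoc, ← smul_sub, inv_smul_eq_iff₀ hne, dn_mul_mono, mono_mul_dn,
      qrInt_zero]
    module
  | succ i ih =>
    obtain ⟨b, hb, hb'⟩ := ih (j + 1) (by simp)
    have hne : r ^ (i + 1) * q ^ j - 1 ≠ 0 := sub_ne_zero.mpr (hqr.pow_mul_pow_ne_one _ _ hij)
    refine ⟨(r ^ (i + 1) * q ^ j - 1)⁻¹ • (mono q r (i + 1) j (i + 1) - qrInt q r (i + 1) • b),
      Submodule.smul_mem _ _ (Submodule.sub_mem _ (mono_mem_weightZero _ j)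
        (Submodule.smul_mem _ _ hb)), ?_⟩
    rw [mul_smul_comm, smul_mul_assoc, ← smul_sub, inv_smul_eq_iff₀ hne, mul_sub, sub_mul,
      mul_smul_comm, smul_mul_assoc, sub_sub_sub_comm, ← smul_sub, hb', dn_mul_mono, mono_mul_dn,
      Nat.add_sub_cancel]
    module

/-- An element of weight one is a commutator of `d` with an element of weight zero, up to a multiple
of `d`. -/
theorem exists_dn_commutator_eq (hqr : GoodRoots q r) {p : SplitAlg q r}
    (hp : ∀ i j k, i + 1 ≠ k → co q r i j k p = 0) :
    ∃ a ∈ weightZero q r, ∃ c : K, p = (dn q r * a - a * dn q r) + c • dn q r := by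
  let f : SplitAlg q r →ₗ[K] SplitAlg q r :=
    LinearMap.mulLeft K (dn q r) - LinearMap.mulRight K (dn q r)
  have hmem : p ∈ (weightZero q r).map f ⊔ Submodule.span K {dn q r} := by
    rw [← expand_coord q r p]
    refine Submodule.sum_mem _ fun ⟨i, j, k⟩ _ => ?_
    by_cases hik : i + 1 = k
    · refine Submodule.smul_mem _ _ ?_
      subst hik
      by_cases hij : (i, j) = (0, 0)
      · obtain ⟨rfl, rfl⟩ := Prod.mk.inj hij
        refine Submodule.mem_sup_right (Submodule.subset_span ?_)
        simp [mono]
      · obtain ⟨a, ha, ha'⟩ := exists_dn_commutator_eq_mono hqr i j hij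
        exact Submodule.mem_sup_left ⟨a, ha, ha'⟩
    · have h0 : coord q r p (i, j, k) = 0 := hp i j k hik
      simp [h0]
  obtain ⟨_, ⟨a, ha, rfl⟩, y, hy, hp'⟩ := Submodule.mem_sup.mp hmem
  obtain ⟨c, rfl⟩ := Submodule.mem_span_singleton.mp hy
  exact ⟨a, ha, c, hp'.symm⟩

/-- A derivation of weight zero that kills `d`, and for which `u` does not occur in `δ(u)`, is zero.
-/
theorem snd_eq_zero (hqr : GoodRoots q r) {s : SplitAlg q r} (h : IsCocycle q r 0 s)
    (hs : ∀ i j k, i ≠ k + 1 → co q r i j k s = 0) (h0 : co q r 1 0 0 s = 0) : s = 0 := by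
  set w := nzValue q r 0 s with hw
  have hws : w = dn q r * s - r • (s * dn q r) := by simp [hw, nzValue]
  have hdw : dn q r * w = q • (w * dn q r) := by simpa using h.dn_nz
  -- `d w = q w d` determines the coefficients of `w = δ(z)` from those with a lower power of `z`.
  have hwij : ∀ j i, co q r i j i w = 0 := by
    intro j
    induction j with
    | zero =>
      intro i
      have e := congrArg (co q r i 0 (i + 1)) hdw
      rw [map_smul, co_mul_dn_succ, co_dn_mul_zero_succ, smul_eq_mul] at e
      -- For `i = 1` the factor `r - q` may vanish, but this coefficient comes from that of `u`.
      by_cases hi : i = 1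
      · subst hi
        rw [hws, map_sub, map_smul, co_mul_dn_succ, co_dn_mul_zero_succ, h0]
        simp
      · have hne : r ^ i - q ≠ 0 := by
          refine sub_ne_zero.mpr ?_
          obtain rfl | hi2 : i = 0 ∨ 2 ≤ i := by omega
          · simpa using (hqr.pow_mul_pow_ne_one 0 1 (by simp)).symm
          · exact hqr.pow_ne i hi2
        refine (mul_eq_zero.mp ?_).resolve_left hne
        linear_combination e
    | succ j ih =>
      intro i
      by_cases hij : (i, j) = (0, 0)
      · obtain ⟨rfl, rfl⟩ := Prod.mk.inj hij
        rw [hws, map_sub, map_smul, co_mul_dn_zero, co_dn_mul_succ_zero, h0]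
        simp
      · have e := congrArg (co q r i (j + 1) (i + 1)) hdw
        rw [map_smul, co_mul_dn_succ, co_dn_mul_succ_succ, ih, smul_eq_mul] at e
        have hne : r ^ i * q ^ j - 1 ≠ 0 := sub_ne_zero.mpr (hqr.pow_mul_pow_ne_one i j hij)
        refine (mul_eq_zero.mp ?_).resolve_left (mul_ne_zero hqr.ne_zero hne)
        linear_combination e
  -- Since `w = 0`, also `d s = r s d`. For `r = 0` this is `d s = 0`, where `[n + 1] = qⁿ ≠ 0`.
  have hsij : ∀ j i, co q r (i + 1) j i s = 0 := by
    by_cases hr : r = 0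
    · intro j i
      have e := hwij (j + 1) i
      rw [hws, map_sub, map_smul, smul_eq_mul, mul_eq_zero_of_left hr, sub_zero] at e
      have hne : qrInt q r (i + 1) ≠ 0 := by
        rw [qrInt_succ', hr, zero_mul, add_zero]
        exact pow_ne_zero i hqr.ne_zero
      refine (mul_eq_zero.mp ?_).resolve_left hne
      cases i with
      | zero => rwa [co_dn_mul_succ_zero] at e
      | succ i =>
        have hri : r ^ (i + 1) = 0 := by rw [hr, zero_pow i.succ_ne_zero]
        rwa [co_dn_mul_succ_succ, hri, zero_mul, zero_mul, zero_add] at e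
    · intro j
      induction j with
      | zero =>
        intro i
        cases i with
        | zero => exact h0
        | succ i =>
          have e := hwij 0 (i + 2)
          rw [hws, map_sub, map_smul, co_mul_dn_succ, co_dn_mul_zero_succ, smul_eq_mul] at e
          have hne : r ^ (i + 1) * q ^ 0 - 1 ≠ 0 :=
            sub_ne_zero.mpr (hqr.pow_mul_pow_ne_one _ _ (by simp))
          refine (mul_eq_zero.mp ?_).resolve_left (mul_ne_zero hr hne)
          linear_combination e
      | succ j ih =>
        intro i
        have e := hwij (j + 1) (i + 1)
        rw [hws, map_sub, map_smul, co_mul_dn_succ, co_dn_mul_succ_succ, ih, smul_eq_mul] at e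
        have hne : r ^ i * q ^ (j + 1) - 1 ≠ 0 :=
          sub_ne_zero.mpr (hqr.pow_mul_pow_ne_one _ _ (by simp))
        refine (mul_eq_zero.mp ?_).resolve_left (mul_ne_zero hr hne)
        linear_combination e
  refine co_ext q r fun i j k => ?_
  rw [map_zero]
  by_cases hik : i = k + 1
  · rw [hik, hsij]
  · exact hs i j k hik

/-- Over a field containing the roots, every cocycle is the sum of a coboundary and
of a combination of the Euler cocycles. -/
theorem IsCocycle.exists_eq (hqr : GoodRoots q r) {p s : SplitAlg q r} (h : IsCocycle q r p s) :
    ∃ (a : SplitAlg q r) (c e : K), p = (dn q r * a - a * dn q r) + c • dn q r ∧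
      s = (up q r * a - a * up q r) + e • up q r := by
  obtain ⟨a₁, ha₁⟩ := h.exists_nzValue_sub_mem hqr
  have h₁ := h.sub (isCocycle_inner a₁)
  rw [← nzValue_inner, ← nzValue_sub] at ha₁
  set p₁ := p - (dn q r * a₁ - a₁ * dn q r) with hp₁
  set s₁ := s - (up q r * a₁ - a₁ * up q r) with hs₁
  obtain ⟨a₂, ha₂, c, hc⟩ := exists_dn_commutator_eq hqr fun i j k => h₁.co_fst_eq_zero hqr ha₁ j
  have h₂ := h₁.sub (isCocycle_inner a₂)
  set e := co q r 1 0 0 (s₁ - (up q r * a₂ - a₂ * up q r)) with he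
  have h₃ := h₂.sub (isCocycle_euler c e)
  have hw₃ := Submodule.sub_mem _ ha₁ (Submodule.smul_mem _ (c + e) nz_mem_weightZero)
  have hp₃ : p₁ - (dn q r * a₂ - a₂ * dn q r) - c • dn q r = 0 := by rw [hc]; abel
  rw [← sub_zero (nzValue q r p₁ s₁), ← nz_commute_of_mem_weightZero ha₂, ← nzValue_inner,
    ← nzValue_euler, ← nzValue_sub, ← nzValue_sub] at hw₃
  have hs₃ := fun i j k => h₃.co_snd_eq_zero hqr hw₃ (i := i) (k := k) j
  rw [hp₃] at h₃
  have hs := snd_eq_zero hqr h₃ hs₃ (by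
    have : co q r 1 0 0 (up q r) = 1 := by simpa [mono] using co_mono q r 1 0 0 1 0 0
    rw [map_sub, map_smul, this, he, smul_eq_mul, mul_one, sub_self])
  refine ⟨a₁ + a₂, c, e, ?_, ?_⟩
  · rw [eq_add_of_sub_eq hp₁.symm, hc]
    noncomm_ring
  · rw [sub_eq_zero, sub_eq_iff_eq_add, hs₁, sub_eq_iff_eq_add] at hs
    rw [hs]
    noncomm_ring

end Cocycles

/-! ### Derivations and cocycles -/

section Derivations

variable {K : Type*} [Field K] (α β γ : K)

theorem hochschildZ1_algebraMap {A : Type*} [Ring A] [Algebra K A] {f : A →ₗ[K] A}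
    (hf : f ∈ HochschildZ1 K A) (c : K) : f (algebraMap K A c) = 0 := by
  have h := hochschildZ1_leibniz K A hf 1 1
  simp only [mul_one, one_mul, left_eq_add] at h
  rw [Algebra.algebraMap_eq_smul_one, map_smul, h, smul_zero]

theorem restrictZ1_injective : Function.Injective (restrictZ1 α β γ) := by
  rw [← LinearMap.ker_eq_bot, LinearMap.ker_eq_bot']
  rintro ⟨f, hf⟩ h
  have hg : ∀ g, f (gen α β γ g) = 0 := fun g => congrFun (congrArg Subtype.val h) g
  refine Subtype.ext (LinearMap.ext fun a => ?_)
  change f a = 0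
  induction a using Alg.induction with
  | algebraMap c => exact hochschildZ1_algebraMap hf c
  | gen g => exact hg g
  | mul a b ha hb => rw [hochschildZ1_leibniz K _ hf, ha, hb, mul_zero, zero_mul, add_zero]
  | add a b ha hb => rw [map_add, ha, hb, add_zero]

/-- A cocycle `x` extends to a derivation, the infinitesimal part of the algebra map
`g ↦ g + ε x(g)` to the dual numbers over `A(α, β, γ)`. -/
theorem restrictZ1_surjective : Function.Surjective (restrictZ1 α β γ) := by
  rintro ⟨x, hx⟩
  have hx' := LinearMap.mem_ker.mp hx
  have e₁ := congrArg Prod.fst hx'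
  have e₂ := congrArg Prod.snd hx'
  simp only [koszulD1, LinearMap.coe_mk, AddHom.coe_mk, Prod.fst_zero, Prod.snd_zero] at e₁ e₂
  let A := Alg α β γ
  let y : Gen → TrivSqZeroExt A A := fun g =>
    TrivSqZeroExt.inl (gen α β γ g) + TrivSqZeroExt.inr (x g)
  have y_fst (g) : (y g).fst = gen α β γ g := by simp [y]
  have y_snd (g) : (y g).snd = x g := by simp [y]
  let φ : A →ₐ[K] TrivSqZeroExt A A := lift α β γ y
    (by
      refine TrivSqZeroExt.ext ?_ ?_
      · simp only [TrivSqZeroExt.fst_mul, TrivSqZeroExt.fst_add, TrivSqZeroExt.fst_smul, y_fst]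
        exact gen_ddu α β γ
      · simp only [TrivSqZeroExt.snd_mul, TrivSqZeroExt.snd_add, TrivSqZeroExt.snd_smul, y_fst,
          y_snd, TrivSqZeroExt.fst_mul, smul_eq_mul, op_smul_eq_mul]
        rw [← sub_eq_zero, ← e₁]
        simp only [add_mul]
        module)
    (by
      refine TrivSqZeroExt.ext ?_ ?_
      · simp only [TrivSqZeroExt.fst_mul, TrivSqZeroExt.fst_add, TrivSqZeroExt.fst_smul, y_fst]
        exact gen_duu α β γ
      · simp only [TrivSqZeroExt.snd_mul, TrivSqZeroExt.snd_add, TrivSqZeroExt.snd_smul, y_fst,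
          y_snd, TrivSqZeroExt.fst_mul, smul_eq_mul, op_smul_eq_mul]
        rw [← sub_eq_zero, ← e₂]
        simp only [add_mul]
        module)
  have φ_gen (g) : φ (gen α β γ g) = y g := lift_gen ..
  have φ_fst (a : A) : (φ a).fst = a := by
    induction a using Alg.induction with
    | algebraMap c => rw [AlgHom.commutes]; rfl
    | gen g => rw [φ_gen, y_fst]
    | mul a b ha hb => rw [map_mul, TrivSqZeroExt.fst_mul, ha, hb]
    | add a b ha hb => rw [map_add, TrivSqZeroExt.fst_add, ha, hb]
  let f : A →ₗ[K] A :=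
    { toFun := fun a => (φ a).snd
      map_add' := fun a b => by rw [map_add, TrivSqZeroExt.snd_add]
      map_smul' := fun c a => by rw [map_smul, TrivSqZeroExt.snd_smul, RingHom.id_apply] }
  have hf : f ∈ HochschildZ1 K A := by
    rw [LinearMap.mem_ker]
    ext a b
    have h : (φ (a * b)).snd = a * (φ b).snd + (φ a).snd * b := by
      rw [map_mul, TrivSqZeroExt.snd_mul, φ_fst, φ_fst, smul_eq_mul, op_smul_eq_mul]
    rw [hochschildD1_apply]
    change a * (φ b).snd - (φ (a * b)).snd + (φ a).snd * b = 0
    rw [h]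
    abel
  refine ⟨⟨f, hf⟩, Subtype.ext (funext fun g => ?_)⟩
  change (φ (gen α β γ g)).snd = x g
  rw [φ_gen, y_snd]

theorem comparison_bijective : Function.Bijective (comparison α β γ) := by
  constructor
  · rw [← LinearMap.ker_eq_bot, LinearMap.ker_eq_bot']
    intro y hy
    obtain ⟨f, rfl⟩ := Submodule.Quotient.mk_surjective _ y
    rw [comparison, Submodule.mapQ_apply, Submodule.Quotient.mk_eq_zero] at hy
    obtain ⟨a, ha⟩ := hy
    rw [Submodule.Quotient.mk_eq_zero]
    have hmem := hochschildB1_le_hochschildZ1 K (Alg α β γ) ⟨a, rfl⟩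
    have : (⟨hochschildD0 K (Alg α β γ) a, hmem⟩ : HochschildZ1 K (Alg α β γ)) = f :=
      restrictZ1_injective α β γ (Subtype.ext ha)
    exact ⟨a, congrArg Subtype.val this⟩
  · intro y
    obtain ⟨x, rfl⟩ := Submodule.Quotient.mk_surjective _ y
    obtain ⟨f, rfl⟩ := restrictZ1_surjective α β γ x
    exact ⟨Submodule.Quotient.mk f, rfl⟩

theorem koszulEuler_mem (g : Gen) : koszulEuler α β 0 g ∈ KoszulZ1 α β 0 := by
  have h₁ := gen_ddu α β 0
  have h₂ := gen_duu α β 0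
  rw [LinearMap.mem_ker]
  cases g <;> refine Prod.ext ?_ ?_ <;>
    simp [koszulD1, koszulEuler, h₁, h₂] <;> module

end Derivations

/-! ### Base change to a field containing the roots -/

section BaseChange

open scoped TensorProduct

variable {K L : Type*} [Field K] [Field L] [Algebra K L] {α β : K} {q r : L}

/-- The map `A(α, β, 0) → A(α, β, 0)_L` for a field extension `L` containing the roots. -/
noncomputable def toSplit (hα : algebraMap K L α = q + r) (hβ : algebraMap K L β = -(q * r)) :
    Alg α β 0 →ₐ[K] SplitAlg q r :=
  lift α β 0 (gen (q + r) (-(q * r)) 0)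
    (by
      rw [← algebraMap_smul L α, ← algebraMap_smul L β, ← algebraMap_smul L 0, hα, hβ, map_zero]
      exact gen_ddu ..)
    (by
      rw [← algebraMap_smul L α, ← algebraMap_smul L β, ← algebraMap_smul L 0, hα, hβ, map_zero]
      exact gen_duu ..)

theorem toSplit_gen (hα : algebraMap K L α = q + r) (hβ : algebraMap K L β = -(q * r)) (g : Gen) :
    toSplit hα hβ (gen α β 0 g) = gen _ _ 0 g := lift_gen ..

/-- The map to `L ⊗ A(α, β, 0)` that is inverse to the `L`-linear extension of `toSplit`,
giving one direction of the isomorphism `A(α, β, 0)_L ≅ L ⊗ A(α, β, 0)`. -/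
noncomputable def splitToTensor (hα : algebraMap K L α = q + r)
    (hβ : algebraMap K L β = -(q * r)) : SplitAlg q r →ₐ[L] L ⊗[K] Alg α β 0 :=
  lift (q + r) (-(q * r)) 0 (fun g => 1 ⊗ₜ gen α β 0 g)
    (by
      simp only [← hα, ← hβ, algebraMap_smul, Algebra.TensorProduct.tmul_mul_tmul, mul_one, gen_ddu,
        TensorProduct.tmul_add, TensorProduct.tmul_smul, zero_smul, add_zero])
    (by
      simp only [← hα, ← hβ, algebraMap_smul, Algebra.TensorProduct.tmul_mul_tmul, mul_one, gen_duu,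
        TensorProduct.tmul_add, TensorProduct.tmul_smul, zero_smul, add_zero])

theorem splitToTensor_toSplit (hα : algebraMap K L α = q + r) (hβ : algebraMap K L β = -(q * r))
    (a : Alg α β 0) : splitToTensor hα hβ (toSplit hα hβ a) = 1 ⊗ₜ a := by
  induction a using Alg.induction with
  | algebraMap c =>
    rw [AlgHom.commutes, IsScalarTower.algebraMap_apply K L, AlgHom.commutes,
      ← IsScalarTower.algebraMap_apply K L, Algebra.TensorProduct.algebraMap_apply,
      Algebra.algebraMap_eq_smul_one, Algebra.algebraMap_eq_smul_one, TensorProduct.smul_tmul]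
  | gen g => rw [toSplit_gen]; exact lift_gen ..
  | mul a b ha hb => rw [map_mul, map_mul, ha, hb, Algebra.TensorProduct.tmul_mul_tmul, mul_one]
  | add a b ha hb => rw [map_add, map_add, ha, hb, TensorProduct.tmul_add]

/-- A `K`-linear retraction `L → K` induces a retraction of `A(α, β, 0)_L` onto `A(α, β, 0)`,
linear over `A(α, β, 0)` on both sides. -/
theorem exists_retraction (hα : algebraMap K L α = q + r) (hβ : algebraMap K L β = -(q * r)) :
    ∃ (π : L →ₗ[K] K) (ρ : SplitAlg q r →ₗ[K] Alg α β 0),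
      (∀ a, ρ (toSplit hα hβ a) = a) ∧ (∀ c a, ρ (c • toSplit hα hβ a) = π c • a) ∧
      (∀ a x, ρ (toSplit hα hβ a * x) = a * ρ x) ∧ ∀ a x, ρ (x * toSplit hα hβ a) = ρ x * a := by
  obtain ⟨π, hπ⟩ := LinearMap.exists_leftInverse_of_injective (Algebra.linearMap K L)
    (LinearMap.ker_eq_bot.mpr (algebraMap K L).injective)
  have hπ1 : π 1 = 1 := by simpa using LinearMap.congr_fun hπ 1
  let ψ : L ⊗[K] Alg α β 0 →ₗ[K] Alg α β 0 :=
    (TensorProduct.lid K (Alg α β 0)).toLinearMap.comp (π.rTensor (Alg α β 0))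
  have hψ (c : L) (a : Alg α β 0) : ψ (c ⊗ₜ a) = π c • a := by simp [ψ]
  have hl (a : Alg α β 0) (y) : ψ ((1 ⊗ₜ a) * y) = a * ψ y := by
    induction y with
    | zero => simp
    | add y y' h h' => rw [mul_add, map_add, h, h', map_add, mul_add]
    | tmul c b => rw [Algebra.TensorProduct.tmul_mul_tmul, one_mul, hψ, hψ, mul_smul_comm]
  have hr (a : Alg α β 0) (y) : ψ (y * (1 ⊗ₜ a)) = ψ y * a := by
    induction y with
    | zero => simp
    | add y y' h h' => rw [add_mul, map_add, h, h', map_add, add_mul]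
    | tmul c b => rw [Algebra.TensorProduct.tmul_mul_tmul, mul_one, hψ, hψ, smul_mul_assoc]
  let Ψ : SplitAlg q r →ₗ[K] Alg α β 0 :=
    ψ.comp ((splitToTensor hα hβ).toLinearMap.restrictScalars K)
  have hΨ (x) : Ψ x = ψ (splitToTensor hα hβ x) := rfl
  refine ⟨π, Ψ, fun a => ?_, fun c a => ?_, fun a x => ?_, fun a x => ?_⟩
  · rw [hΨ, splitToTensor_toSplit, hψ, hπ1, one_smul]
  · rw [hΨ, map_smul, splitToTensor_toSplit, TensorProduct.smul_tmul', hψ, smul_eq_mul, mul_one]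
  · rw [hΨ, map_mul, splitToTensor_toSplit, hl, hΨ]
  · rw [hΨ, map_mul, splitToTensor_toSplit, hr, hΨ]

/-- The components of `d₁*` are the linearised relations, which are those of `IsCocycle` with
`z = du - r ud` expanded. -/
theorem isCocycle_toSplit (hα : algebraMap K L α = q + r) (hβ : algebraMap K L β = -(q * r))
    {x : Gen → Alg α β 0} (hx : x ∈ KoszulZ1 α β 0) :
    IsCocycle q r (toSplit hα hβ (x Gen.d)) (toSplit hα hβ (x Gen.u)) := by
  have hx' := LinearMap.mem_ker.mp hx
  have e₁ := congrArg (toSplit hα hβ) (congrArg Prod.fst hx')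
  have e₂ := congrArg (toSplit hα hβ) (congrArg Prod.snd hx')
  simp only [koszulD1, LinearMap.coe_mk, AddHom.coe_mk, Prod.fst_zero, Prod.snd_zero, map_sub,
    map_smul, map_add, map_mul, toSplit_gen, map_zero, zero_smul, sub_zero] at e₁ e₂
  rw [← algebraMap_smul L α, ← algebraMap_smul L β, hα, hβ] at e₁ e₂
  constructor
  · rw [← sub_eq_zero, ← e₁, nzValue, nz]
    simp only [mul_add, add_mul, mul_sub, sub_mul, smul_mul_assoc, mul_smul_comm, ← mul_assoc]
    module
  · rw [← sub_eq_zero, ← e₂, nzValue, nz]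
    simp only [mul_add, add_mul, mul_sub, sub_mul, smul_mul_assoc, mul_smul_comm, ← mul_assoc]
    module

/-- Every cocycle is a coboundary plus a combination of the Euler cocycles: this holds over `L`,
and the retraction brings the equations back to `K`. -/
theorem koszulZ1_exists_eq (hqr : GoodRoots q r) (hα : algebraMap K L α = q + r)
    (hβ : algebraMap K L β = -(q * r)) {x : Gen → Alg α β 0} (hx : x ∈ KoszulZ1 α β 0) :
    ∃ (a : Alg α β 0) (c e : K), x = koszulD0 α β 0 a + c • koszulEuler α β 0 Gen.d
      + e • koszulEuler α β 0 Gen.u := by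
  obtain ⟨a, c, e, hp, hs⟩ := (isCocycle_toSplit hα hβ hx).exists_eq hqr
  obtain ⟨π, ρ, h₁, h₂, hl, hr⟩ := exists_retraction hα hβ
  rw [dn, ← toSplit_gen hα hβ] at hp
  rw [up, ← toSplit_gen hα hβ] at hs
  have hp' := congrArg ρ hp
  have hs' := congrArg ρ hs
  rw [map_add, map_sub, h₁, h₂, hl, hr] at hp' hs'
  refine ⟨ρ a, π c, π e, funext fun g => ?_⟩
  cases g
  · simpa [koszulD0, koszulEuler] using hp'
  · simpa [koszulD0, koszulEuler] using hs'

/-- The Euler cocycles are independent modulo coboundaries, as `d` has coefficient zero in `da - ad`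
and `u` in `ua - au`. -/
theorem euler_eq_koszulD0 (hα : algebraMap K L α = q + r) (hβ : algebraMap K L β = -(q * r))
    {a : Alg α β 0} {c e : K} (h : koszulD0 α β 0 a = c • koszulEuler α β 0 Gen.d
      + e • koszulEuler α β 0 Gen.u) : c = 0 ∧ e = 0 := by
  have hd := congrArg (toSplit hα hβ) (congrFun h Gen.d)
  have hu := congrArg (toSplit hα hβ) (congrFun h Gen.u)
  simp [koszulD0, koszulEuler, toSplit_gen] at hd hu
  rw [← algebraMap_smul L] at hd hu
  have hd' := congrArg (co q r 0 0 1) hd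
  have hu' := congrArg (co q r 1 0 0) hu
  have h1 : co q r 0 0 1 (dn q r) = 1 := by simpa [mono] using co_mono q r 0 0 1 0 0 1
  have h2 : co q r 1 0 0 (up q r) = 1 := by simpa [mono] using co_mono q r 1 0 0 1 0 0
  rw [map_sub, map_smul, h1, co_dn_mul_zero_succ, co_mul_dn_succ] at hd'
  rw [map_sub, map_smul, h2, co_up_mul_succ, co_mul_up_succ_zero] at hu'
  simpa using And.intro hd'.symm hu'.symm

end BaseChange

/-- The roots in an algebraic closure can be labelled so as to be good. If both are nonzero and
`r ^ n = q` for some `n ≥ 2`, the labels are exchanged: `q ^ m = r` would make `r` a root of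
unity. -/
theorem IsGradedGeneric.exists_goodRoots {K : Type*} [Field K] {α β : K}
    (hA : IsGradedGeneric α β) :
    ∃ q r : AlgebraicClosure K, GoodRoots q r ∧ algebraMap K _ α = q + r ∧
      algebraMap K _ β = -(q * r) := by
  obtain ⟨h0, h1⟩ := hA
  set a := algebraMap K (AlgebraicClosure K) α with ha
  set b := algebraMap K (AlgebraicClosure K) β with hb
  obtain ⟨r₁, hr₁⟩ := IsAlgClosed.exists_root
    (Polynomial.X ^ 2 - Polynomial.C a * Polynomial.X - Polynomial.C b) (by
      have : (Polynomial.X ^ 2 - Polynomial.C a * Polynomial.X - Polynomial.C b).degree = 2 := by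
        compute_degree!
      simp [this])
  obtain ⟨r₂, hr₂⟩ : ∃ r₂, a = r₁ + r₂ := ⟨a - r₁, by ring⟩
  have hprod : b = -(r₁ * r₂) := by
    simp only [Polynomial.IsRoot, Polynomial.eval_sub, Polynomial.eval_pow, Polynomial.eval_X,
      Polynomial.eval_mul, Polynomial.eval_C, hr₂] at hr₁
    linear_combination -hr₁
  have hgen : ∀ i j : ℕ, (i, j) ≠ (0, 0) → r₁ ^ i * r₂ ^ j ≠ 1 := by
    refine h1 r₁ r₂ ?_
    rw [hr₂, hprod]
    simp only [Polynomial.C_add, Polynomial.C_neg, Polynomial.C_mul]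
    ring
  have hgen' : ∀ i j : ℕ, (i, j) ≠ (0, 0) → r₂ ^ i * r₁ ^ j ≠ 1 := fun i j hij => by
    rw [mul_comm]
    exact hgen j i fun h => hij (by simpa [and_comm] using h)
  have hne : ¬(r₁ = 0 ∧ r₂ = 0) := by
    rintro ⟨rfl, rfl⟩
    refine h0 (Prod.ext ?_ ?_) <;>
      refine (map_eq_zero_iff _ (algebraMap K (AlgebraicClosure K)).injective).mp ?_
    · rw [← ha, hr₂, add_zero]
    · rw [← hb, hprod, mul_zero, neg_zero]
  by_cases hr : r₁ ≠ 0 ∧ ∀ n : ℕ, 2 ≤ n → r₂ ^ n ≠ r₁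
  · exact ⟨r₁, r₂, ⟨hr.1, hgen', hr.2⟩, hr₂, hprod⟩
  have hr' : r₁ = 0 ∨ ∃ n : ℕ, 2 ≤ n ∧ r₂ ^ n = r₁ := by
    by_contra! hcon
    exact hr hcon
  have h2 : r₂ ≠ 0 := by
    rintro rfl
    rcases hr' with h | ⟨n, hn, h⟩
    · exact hne ⟨h, rfl⟩
    · exact hne ⟨by rw [← h, zero_pow (by omega)], rfl⟩
  refine ⟨r₂, r₁, ⟨h2, hgen, fun m hm hmr => ?_⟩, by rw [hr₂, add_comm], by rw [hprod, mul_comm]⟩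
  rcases hr' with rfl | ⟨n, hn, h⟩
  · exact h2 (by rw [← hmr, zero_pow (by omega)])
  · obtain ⟨c, hc⟩ : ∃ c, n * m = c + 1 + 1 := ⟨n * m - 2, by have := Nat.mul_le_mul hn hm; omega⟩
    rw [← h, ← pow_mul, hc, pow_succ] at hmr
    exact hgen 0 (c + 1) (by simp)
      (by simpa using mul_right_cancel₀ h2 (hmr.trans (one_mul _).symm))

end DownUp

theorem proposition4p3 {K : Type*} [Field K] [CharZero K] (α β : K)
    (hA : DownUp.IsGradedGeneric α β) :
    Function.Bijective (DownUp.comparison α β 0) ∧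
    Module.finrank K (HochschildHH1 K (DownUp.Alg α β 0)) = 2 ∧
    ∃ δd δu : HochschildZ1 K (DownUp.Alg α β 0),
      (DownUp.restrictZ1 α β 0 δd : DownUp.Gen → DownUp.Alg α β 0)
        = DownUp.koszulEuler α β 0 DownUp.Gen.d ∧
      (DownUp.restrictZ1 α β 0 δu : DownUp.Gen → DownUp.Alg α β 0)
        = DownUp.koszulEuler α β 0 DownUp.Gen.u ∧
      Submodule.span K
        {(Submodule.Quotient.mk δd : HochschildHH1 K (DownUp.Alg α β 0)),
          Submodule.Quotient.mk δu} = ⊤ := by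
  obtain ⟨q, r, hqr, hα, hβ⟩ := hA.exists_goodRoots
  obtain ⟨δd, hd⟩ := DownUp.restrictZ1_surjective α β 0 ⟨_, DownUp.koszulEuler_mem α β DownUp.Gen.d⟩
  obtain ⟨δu, hu⟩ := DownUp.restrictZ1_surjective α β 0 ⟨_, DownUp.koszulEuler_mem α β DownUp.Gen.u⟩
  have hd' : (DownUp.restrictZ1 α β 0 δd).1 = DownUp.koszulEuler α β 0 DownUp.Gen.d :=
    congrArg Subtype.val hd
  have hu' : (DownUp.restrictZ1 α β 0 δu).1 = DownUp.koszulEuler α β 0 DownUp.Gen.u :=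
    congrArg Subtype.val hu
  -- Restriction to the generators is injective, so equations between derivations lift.
  have key (a : DownUp.Alg α β 0) (c e : K) (f : HochschildZ1 K (DownUp.Alg α β 0))
      (h : (DownUp.restrictZ1 α β 0 f).1 = DownUp.koszulD0 α β 0 a
        + c • DownUp.koszulEuler α β 0 DownUp.Gen.d
        + e • DownUp.koszulEuler α β 0 DownUp.Gen.u) :
      f.1 = hochschildD0 K (DownUp.Alg α β 0) a + c • δd.1 + e • δu.1 := by
    have hmem := hochschildB1_le_hochschildZ1 K (DownUp.Alg α β 0) ⟨a, rfl⟩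
    rw [← hd', ← hu'] at h
    exact congrArg Subtype.val
      (DownUp.restrictZ1_injective α β 0 (a₂ := ⟨_, hmem⟩ + c • δd + e • δu) (Subtype.ext h))
  have hspan : Submodule.span K {(Submodule.Quotient.mk δd : HochschildHH1 K (DownUp.Alg α β 0)),
      Submodule.Quotient.mk δu} = ⊤ := by
    refine eq_top_iff.mpr fun y _ => ?_
    obtain ⟨f, rfl⟩ := Submodule.Quotient.mk_surjective _ y
    obtain ⟨a, c, e, h⟩ := DownUp.koszulZ1_exists_eq hqr hα hβ (DownUp.restrictZ1 α β 0 f).2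
    refine Submodule.mem_span_pair.mpr ⟨c, e, ?_⟩
    rw [← Submodule.Quotient.mk_smul, ← Submodule.Quotient.mk_smul, ← Submodule.Quotient.mk_add,
      eq_comm, Submodule.Quotient.eq]
    refine ⟨a, ?_⟩
    change _ = f.1 - (c • δd.1 + e • δu.1)
    rw [key a c e f h]
    abel
  have hli : LinearIndependent K ![(Submodule.Quotient.mk δd : HochschildHH1 K (DownUp.Alg α β 0)),
      Submodule.Quotient.mk δu] := by
    refine LinearIndependent.pair_iff.mpr fun c e h => ?_
    rw [← Submodule.Quotient.mk_smul, ← Submodule.Quotient.mk_smul, ← Submodule.Quotient.mk_add,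
      Submodule.Quotient.mk_eq_zero] at h
    obtain ⟨a, ha⟩ := h
    refine DownUp.euler_eq_koszulD0 hα hβ (a := a) ?_
    rw [← hd', ← hu']
    funext g
    exact LinearMap.congr_fun ha (DownUp.gen α β 0 g)
  refine ⟨DownUp.comparison_bijective α β 0, ?_, δd, δu, hd', hu', hspan⟩
  rw [Module.finrank_eq_card_basis (Module.Basis.mk hli (by
    rw [Matrix.range_cons, Matrix.range_cons, Matrix.range_empty, Set.union_empty,
      Set.singleton_union, hspan])), Fintype.card_fin]
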